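/- Let $K$ be a field and $R=K[x_1,\dots,x_n]$. For a monomial ideal $M$ of $R$ (an ideal generated by monomials) let $m_1,\dots,m_p$ be its minimal monomial generators, listed in any order. The Taylor complex $\mathbb{T}(M)$ has as $\mathbb{T}(M)_i$ the free $R$-module with basis the symbols $e_{j_1}\wedge\cdots\wedge e_{j_i}$, $1\le j_1<\cdots<j_i\le p$, and differential $$\delta(e_{j_1}\wedge\cdots\wedge e_{j_i})=\sum_{k=1}^{i}(-1)^{k-1}\frac{\operatorname{lcm}(m_{j_1},\dots,m_{j_i})}{\operatorname{lcm}(m_{j_1},\dots,\widehat{m_{j_k}},\dots,m_{j_i})}\;e_{j_1}\wedge\cdots\wedge\widehat{e_{j_k}}\wedge\cdots\wedge e_{j_i}.$$ It is $\mathbb{N}^n$-graded by giving $e_{j_1}\wedge\cdots\wedge e_{j_i}$ the exponent vector of $\operatorname{lcm}(m_{j_1},\dots,m_{j_i})$ as its multidegree. In a tensor product over $R$, $x\otimes y$ has multidegree $a+b$ if $x$ and $y$ are homogeneous of multidegrees $a$ and $b$. **Theorem.** Let $I$ and $J$ be proper monomial ideals of $R$ that intersect transversally, i.e. $I\cap J=IJ$.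 Then there is an isomorphism of complexes of $R$-modules $\mathbb{T}(I)\otimes_R\mathbb{T}(J)\cong\mathbb{T}(I+J)$ that identifies, in every homological degree, the multigraded components of the two sides. Hence $\mathbb{T}(I)\otimes_R\mathbb{T}(J)$ is acyclic, i.e. its homology vanishes in all degrees $r\ge 1$, and $H_0(\mathbb{T}(I)\otimes_R\mathbb{T}(J))\cong R/(I+J)$. -/

import Mathlib

open CategoryTheory MvPolynomial
open scoped TensorProduct

noncomputable section

namespace Taylor

universe u

variable {n : ℕ} {K : Type u} [Field K]

/-- An ideal of `K[x₁, …, xₙ]` is monomial if it is generated by a set of monomials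
`x ^ a`, `a ∈ S` (monomials are represented by their exponent vectors). -/
def IsMonomial (I : Ideal (MvPolynomial (Fin n) K)) : Prop :=
  ∃ S : Set (Fin n →₀ ℕ), I = Ideal.span ((fun a => monomial a (1 : K)) '' S)

/-- The set `G(I)` of the minimal monomial generators of `I`: (the exponents of) the monomials
in `I` that are minimal with respect to divisibility. -/
def minGens (I : Ideal (MvPolynomial (Fin n) K)) : Set (Fin n →₀ ℕ) :=
  {a | Minimal (fun b => monomial b (1 : K) ∈ I) a}

/-- `G(I)` is the unique minimal monomial generating set of a monomial ideal `I`: it generates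
`I` and is contained in every other set of monomials that generates `I`. -/
theorem IsMonomial.isLeast_minGens {I : Ideal (MvPolynomial (Fin n) K)} (hI : IsMonomial I) :
    IsLeast {S : Set (Fin n →₀ ℕ) | Ideal.span ((fun a => monomial a (1 : K)) '' S) = I}
      (minGens I) := by
  refine ⟨?_, ?_⟩
  · apply le_antisymm
    · rw [Ideal.span_le]
      rintro _ ⟨a, ha, rfl⟩
      exact ha.1
    · obtain ⟨S, hS⟩ := hI
      conv_lhs => rw [hS]
      rw [Ideal.span_le]
      rintro _ ⟨a, ha, rfl⟩
      have haI : monomial a (1 : K) ∈ I := hS ▸ Ideal.subset_span ⟨a, ha, rfl⟩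
      obtain ⟨b, hb, hmin⟩ := exists_minimal_le_of_wellFoundedLT
        (fun b => monomial b (1 : K) ∈ I) a haI
      exact mem_ideal_span_monomial_image.2 fun c hc => by
        have : c = a := by
          have := support_monomial_subset hc
          simpa using this
        exact ⟨b, hmin, this ▸ hb⟩
  · intro S hS a ha
    obtain ⟨haI, hmin⟩ := ha
    have h1 := haI
    rw [← hS, mem_ideal_span_monomial_image] at h1
    obtain ⟨b, hb, hba⟩ := h1 a (by simp)
    have hbI : monomial b (1 : K) ∈ I := hS ▸ Ideal.subset_span ⟨b, hb, rfl⟩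
    rwa [le_antisymm (hmin hbI hba) hba]

section Family

variable (K) {ι : Type} [LinearOrder ι] (m : ι → Fin n →₀ ℕ)

/-- The free module with basis the symbols `e_S = e_{j₁} ∧ ⋯ ∧ e_{jᵢ}`, for the subsets
`S = {j₁ < ⋯ < jᵢ}` of the index set. -/
abbrev TaylorModule (n : ℕ) (K : Type u) [Field K] (ι : Type) (i : ℕ) : Type u :=
  {S : Finset ι // S.card = i} →₀ MvPolynomial (Fin n) K

/-- The exponent of `lcm (m_j : j ∈ S)`, which is the multidegree of `e_S`. -/
abbrev lcmExp (S : Finset ι) : Fin n →₀ ℕ := S.sup m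

/-- The value of the Taylor differential at `e_S`. The sign at `j ∈ S` is `(-1) ^ (k - 1)`
where `j` is the `k`-th element of `S`. -/
def dBasis (i : ℕ) (S : {S : Finset ι // S.card = i + 1}) : TaylorModule n K ι i :=
  ∑ j : {j // j ∈ S.1},
    Finsupp.single ⟨S.1.erase j.1, by rw [Finset.card_erase_of_mem j.2, S.2]; rfl⟩
      (monomial (lcmExp m S.1 - lcmExp m (S.1.erase j.1))
        ((-1 : K) ^ (S.1.filter (· < j.1)).card))

/-- The Taylor differential. -/
def d (i : ℕ) :
    TaylorModule n K ι (i + 1) →ₗ[MvPolynomial (Fin n) K] TaylorModule n K ι i :=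
  Finsupp.linearCombination _ (dBasis K m i)

theorem sign_swap (S : Finset ι) {j k : ι} (hj : j ∈ S) (hk : k ∈ S) (hjk : j ≠ k) :
    (-1 : K) ^ (S.filter (· < j)).card * (-1) ^ ((S.erase j).filter (· < k)).card +
      (-1 : K) ^ (S.filter (· < k)).card * (-1) ^ ((S.erase k).filter (· < j)).card = 0 := by
  wlog h : j < k generalizing j k
  · rw [add_comm]
    exact this hk hj hjk.symm (lt_of_le_of_ne (not_lt.1 h) hjk.symm)
  have h1 : (S.erase k).filter (· < j) = S.filter (· < j) := by
    rw [Finset.filter_erase, Finset.erase_eq_of_notMem]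
    simp [h.le]
  have h2 : (S.filter (· < k)).card = ((S.erase j).filter (· < k)).card + 1 := by
    rw [Finset.filter_erase, Finset.card_erase_add_one]
    simp [hj, h]
  rw [h1, h2]
  ring

theorem d_comp_d (i : ℕ) : d K m i ∘ₗ d K m (i + 1) = 0 := by
  refine Finsupp.lhom_ext' fun S => LinearMap.ext_ring ?_
  simp only [d, dBasis, LinearMap.comp_apply, Finsupp.lsingle_apply,
    Finsupp.linearCombination_single, one_smul, map_sum, Finset.smul_sum, Finsupp.smul_single,
    smul_eq_mul, monomial_mul, LinearMap.zero_apply]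
  rw [Finset.sum_sigma']
  refine Finset.sum_involution
    (fun x _ => ⟨⟨x.2.1, Finset.mem_of_mem_erase x.2.2⟩,
      ⟨x.1.1, Finset.mem_erase.2 ⟨(Finset.ne_of_mem_erase x.2.2).symm, x.1.2⟩⟩⟩) ?_ ?_ ?_ ?_
  · rintro ⟨⟨j, hj⟩, ⟨k, hk⟩⟩ -
    have hkj := Finset.ne_of_mem_erase hk
    have hkS := Finset.mem_of_mem_erase hk
    have hle1 : lcmExp m ((S.1.erase j).erase k) ≤ lcmExp m (S.1.erase j) :=
      Finset.sup_mono (Finset.erase_subset _ _)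
    have hle2 : lcmExp m ((S.1.erase j).erase k) ≤ lcmExp m (S.1.erase k) := by
      rw [Finset.erase_right_comm]
      exact Finset.sup_mono (Finset.erase_subset _ _)
    have hle3 : lcmExp m (S.1.erase j) ≤ lcmExp m S.1 :=
      Finset.sup_mono (Finset.erase_subset _ _)
    have hle4 : lcmExp m (S.1.erase k) ≤ lcmExp m S.1 :=
      Finset.sup_mono (Finset.erase_subset _ _)
    have e1 := tsub_add_tsub_cancel hle3 hle1
    have e2 := tsub_add_tsub_cancel hle4 hle2
    simp only [Finset.erase_right_comm (a := k) (b := j)]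
    rw [e1, e2, ← Finsupp.single_add, ← map_add, sign_swap K S.1 hj hkS hkj.symm, map_zero,
      Finsupp.single_zero]
  · rintro ⟨⟨j, hj⟩, ⟨k, hk⟩⟩ - - h
    exact Finset.ne_of_mem_erase hk (congrArg (fun x => x.1.1) h)
  · intros
    exact Finset.mem_sigma.2 ⟨Finset.mem_univ _, Finset.mem_univ _⟩
  · rintro ⟨⟨j, hj⟩, ⟨k, hk⟩⟩ -
    rfl

/-- The Taylor complex of a family of monomials `m_j = x ^ (m j)`, `j ∈ ι`. -/
def taylorOfFamily : ChainComplex (ModuleCat.{u} (MvPolynomial (Fin n) K)) ℕ :=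
  ChainComplex.of (fun i => ModuleCat.of _ (TaylorModule n K ι i))
    (fun i => ModuleCat.ofHom (d K m i))
    (fun i => by rw [← ModuleCat.ofHom_comp, d_comp_d]; rfl)

/-- The component of multidegree `a` of the `i`-th module of the Taylor complex: the sums of
elements `c x ^ b e_S` with `c ∈ K` and `x ^ b lcm (m_j : j ∈ S) = x ^ a`. -/
def taylorOfFamilyDeg (i : ℕ) (a : Fin n →₀ ℕ) : AddSubgroup ((taylorOfFamily K m).X i) :=
  AddSubgroup.closure
    {x : TaylorModule n K ι i | ∃ (S : {S : Finset ι // S.card = i}) (b : Fin n →₀ ℕ) (c : K),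
      b + lcmExp m S.1 = a ∧ x = Finsupp.single S (monomial b c)}

end Family

section Ideal

variable (I : Ideal (MvPolynomial (Fin n) K)) [LinearOrder (minGens I)]

/-- The Taylor complex `T(I)` of a monomial ideal, with respect to an enumeration (a linear
order) of the minimal monomial generators of `I`. -/
def taylor : ChainComplex (ModuleCat.{u} (MvPolynomial (Fin n) K)) ℕ :=
  taylorOfFamily K (ι := minGens I) Subtype.val

/-- The component of multidegree `a` of `T(I)_i`. -/
def taylorDeg (i : ℕ) (a : Fin n →₀ ℕ) : AddSubgroup ((taylor I).X i) :=
  taylorOfFamilyDeg K (ι := minGens I) Subtype.val i a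

end Ideal

/-- If the modules of two chain complexes `C` and `D` are given multigradings, this is the
component of multidegree `c` of `(C ⊗ D)_r = ⨁_{i + j = r} C_i ⊗ D_j`: the sums of elements
`x ⊗ y` with `x` and `y` homogeneous of multidegrees that add up to `c`. -/
def tensorDeg (C D : ChainComplex (ModuleCat.{u} (MvPolynomial (Fin n) K)) ℕ)
    (degC : (i : ℕ) → (Fin n →₀ ℕ) → AddSubgroup (C.X i))
    (degD : (i : ℕ) → (Fin n →₀ ℕ) → AddSubgroup (D.X i))
    (r : ℕ) (c : Fin n →₀ ℕ) : AddSubgroup ((HomologicalComplex.tensorObj C D).X r) :=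
  AddSubgroup.closure
    {z | ∃ (i j : ℕ) (h : i + j = r) (a b : Fin n →₀ ℕ) (x : C.X i) (y : D.X j),
      a + b = c ∧ x ∈ degC i a ∧ y ∈ degD j b ∧
        z = (HomologicalComplex.ιTensorObj C D i j r h).hom
          (x ⊗ₜ[MvPolynomial (Fin n) K] y)}

end Taylor

end

/-!
Two facts carry the proof.

*Transversality is coprimality of the generators* (`coprime_of_inf_eq_mul`). If `I ∩ J = I J`, every
minimal generator of `I` is coprime to every minimal generator of `J`; this follows by looking at a
pair of generators that is not coprime and whose lcm is minimal. As both ideals are proper, it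
follows that the minimal generators of `I + J` are those of `I` together with those of `J`,
without repetition (`exists_equiv_minGens_add`).

*The Taylor complex of a coprime union is a tensor product* (`tensorIso`). The isomorphism sends
`e_S ⊗ e_T` to `e_{S ∪ T}`, the generators of `J` being placed after those of `I`. By coprimality
`lcm (S ∪ T) = lcm S * lcm T`, so the multidegrees add up and the coefficients of the differentials
agree; the signs agree because placing `S` before `T` produces the sign `(-1) ^ |S|` of the tensor
product (`totalD_totalJoin_single`). Another order on the generators changes the Taylor complex by
an isomorphism `e_S ↦ ± e_S`, where the sign counts inversions (`reindexIso`).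

The homology is then that of the Taylor complex of `I + J`. In a multidegree `a` that is divisible
by a generator `m_j`, exterior multiplication by `e_j` is a contracting homotopy
(`totalD_homotopy_add`), and every multidegree that occurs in positive homological degree is of this
kind. In degree zero, the image of the differential is the ideal spanned by the generators
(`exists_linearEquiv_range_d_zero`).

Computations with the differential are done in the free module on all finite subsets, the sum of
the modules of all homological degrees, where no proofs about cardinalities are carried along; the
modules of the complex embed in it by `incl`.
-/

noncomputable section

namespace Taylor

universe u

/-! ### Minimal generators of transversal monomial ideals -/

section Generators

variable {n : ℕ} {K : Type u} [Field K] {I J : Ideal (MvPolynomial (Fin n) K)}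

theorem IsMonomial.span_minGens (hI : IsMonomial I) :
    Ideal.span ((fun a => monomial a (1 : K)) '' minGens I) = I :=
  hI.isLeast_minGens.1

theorem monomial_mem_span_iff {S : Set (Fin n →₀ ℕ)} {a : Fin n →₀ ℕ} :
    monomial a (1 : K) ∈ Ideal.span ((fun b => monomial b (1 : K)) '' S) ↔ ∃ b ∈ S, b ≤ a := by
  rw [mem_ideal_span_monomial_image]
  simp

theorem IsMonomial.monomial_mem_iff (hI : IsMonomial I) {a : Fin n →₀ ℕ} :
    monomial a (1 : K) ∈ I ↔ ∃ b ∈ minGens I, b ≤ a := by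
  conv_lhs => rw [← hI.span_minGens]
  exact monomial_mem_span_iff

theorem IsMonomial.monomial_mem_mul_iff (hI : IsMonomial I) (hJ : IsMonomial J)
    {a : Fin n →₀ ℕ} :
    monomial a (1 : K) ∈ I * J ↔ ∃ u ∈ minGens I, ∃ v ∈ minGens J, u + v ≤ a := by
  have h : I * J = Ideal.span ((fun b => monomial b (1 : K)) ''
      Set.image2 (· + ·) (minGens I) (minGens J)) := by
    conv_lhs => rw [← hI.span_minGens, ← hJ.span_minGens, Ideal.span_mul_span']
    congr 1
    rw [← Set.image2_mul, Set.image2_image_left, Set.image2_image_right, Set.image_image2]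
    simp [monomial_mul]
  rw [h, monomial_mem_span_iff]
  simp only [Set.exists_mem_image2]

theorem IsMonomial.sup (hI : IsMonomial I) (hJ : IsMonomial J) : IsMonomial (I + J) := by
  obtain ⟨S, rfl⟩ := hI
  obtain ⟨T, rfl⟩ := hJ
  exact ⟨S ∪ T, by rw [Set.image_union, Ideal.span_union]; rfl⟩

theorem IsMonomial.monomial_mem_add_iff (hI : IsMonomial I) (hJ : IsMonomial J)
    {a : Fin n →₀ ℕ} :
    monomial a (1 : K) ∈ I + J ↔ monomial a (1 : K) ∈ I ∨ monomial a (1 : K) ∈ J := by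
  obtain ⟨S, rfl⟩ := hI
  obtain ⟨T, rfl⟩ := hJ
  rw [Ideal.add_eq_sup, ← Ideal.span_union, ← Set.image_union]
  simp only [monomial_mem_span_iff, Set.mem_union, or_and_right, exists_or]

theorem eq_of_mem_minGens {a b : Fin n →₀ ℕ} (ha : a ∈ minGens I) (hb : b ∈ minGens I)
    (h : a ≤ b) : a = b :=
  le_antisymm h (hb.2 ha.1 h)

theorem zero_notMem_of_ne_top (hI : I ≠ ⊤) : monomial (0 : Fin n →₀ ℕ) (1 : K) ∉ I := fun h =>
  hI ((Ideal.eq_top_iff_one I).2 h)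

/-- If `I ∩ J = I J`, then a minimal generator of `I` and a minimal generator of `J` are coprime.

Among the pairs `(m, m')` that are not coprime take one with `l = lcm (m, m')` minimal. As `l` lies
in `I ∩ J = I J`, it is divisible by some product `u v` of generators. The pair `(u, v)` is
coprime, as its lcm would otherwise be a proper divisor of `l`. If `(u, m')` is not coprime, then
`lcm (u, m') = l` by minimality, so `v` divides `m'`, hence `v = m'`, which is prime to `u`. If it
is coprime, then `u` divides `m`, hence `u = m`, which is not prime to `m'`. -/
theorem coprime_of_inf_eq_mul (hI : IsMonomial I) (hJ : IsMonomial J) (hIJ : I ⊓ J = I * J)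
    {a b : Fin n →₀ ℕ} (ha : a ∈ minGens I) (hb : b ∈ minGens J) (x : Fin n) :
    a x = 0 ∨ b x = 0 := by
  induction hl : a ⊔ b using WellFoundedLT.induction generalizing a b x with
  | ind l ih =>
  subst hl
  by_contra hx
  have hl : monomial (a ⊔ b) (1 : K) ∈ I * J := by
    rw [← hIJ]
    exact ⟨hI.monomial_mem_iff.2 ⟨a, ha, le_sup_left⟩, hJ.monomial_mem_iff.2 ⟨b, hb, le_sup_right⟩⟩
  obtain ⟨u, hu, v, hv, huv⟩ := (hI.monomial_mem_mul_iff hJ).1 hl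
  have huv' : ∀ y, u y + v y ≤ max (a y) (b y) := huv
  have h1 : ∀ y, u y = 0 ∨ v y = 0 := by
    intro y
    by_contra hy
    refine hy (ih (u ⊔ v) (lt_of_le_of_ne (fun z => ?_) fun h => ?_) hu hv y rfl)
    · have := huv' z
      simp only [Finsupp.sup_apply]
      omega
    · have h2 := DFunLike.congr_fun h y
      have := huv' y
      simp only [Finsupp.sup_apply] at h2
      omega
  by_cases h2 : ∀ y, u y = 0 ∨ b y = 0
  · have : u = a := eq_of_mem_minGens hu ha fun y => by
      have := huv' y
      have := h2 y
      omega
    subst this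
    exact hx (h2 x)
  · push Not at h2
    obtain ⟨y, hy⟩ := h2
    have h3 : u ⊔ b = a ⊔ b := by
      by_contra h
      have := ih (u ⊔ b) (lt_of_le_of_ne (fun z => ?_) h) hu hb y rfl
      · omega
      · have := huv' z
        simp only [Finsupp.sup_apply]
        omega
    have : v = b := eq_of_mem_minGens hv hb fun z => by
      have h4 := DFunLike.congr_fun h3 z
      simp only [Finsupp.sup_apply] at h4
      have := huv' z
      have := h1 z
      omega
    subst this
    have := h1 y
    omega

theorem minGens_add_eq_union (hI : IsMonomial I) (hJ : IsMonomial J) (hI1 : I ≠ ⊤) (hJ1 : J ≠ ⊤)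
    (hcop : ∀ a ∈ minGens I, ∀ b ∈ minGens J, ∀ x, a x = 0 ∨ b x = 0) :
    minGens (I + J) = minGens I ∪ minGens J := by
  have key : ∀ {a b : Fin n →₀ ℕ}, (∀ x, a x = 0 ∨ b x = 0) → b ≤ a → b = 0 := by
    intro a b h hle
    ext x
    have h1 : b x ≤ a x := hle x
    have := h x
    simp only [Finsupp.coe_zero, Pi.zero_apply]
    omega
  ext a
  constructor
  · rintro ⟨ha, hmin⟩
    refine ((hI.monomial_mem_add_iff hJ).1 ha).imp (fun h => ⟨h, fun b hb hba => ?_⟩)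
      (fun h => ⟨h, fun b hb hba => ?_⟩)
    · exact hmin ((hI.monomial_mem_add_iff hJ).2 (Or.inl hb)) hba
    · exact hmin ((hI.monomial_mem_add_iff hJ).2 (Or.inr hb)) hba
  · rintro (ha | ha)
    · refine ⟨(hI.monomial_mem_add_iff hJ).2 (Or.inl ha.1), fun b hb hba => ?_⟩
      rcases (hI.monomial_mem_add_iff hJ).1 hb with h | h
      · exact ha.2 h hba
      · obtain ⟨c, hc, hcb⟩ := hJ.monomial_mem_iff.1 h
        have := key (hcop a ha c hc) (hcb.trans hba)
        exact absurd (this ▸ hc.1) (zero_notMem_of_ne_top hJ1)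
    · refine ⟨(hI.monomial_mem_add_iff hJ).2 (Or.inr ha.1), fun b hb hba => ?_⟩
      rcases (hI.monomial_mem_add_iff hJ).1 hb with h | h
      · obtain ⟨c, hc, hcb⟩ := hI.monomial_mem_iff.1 h
        have := key (fun x => (hcop c hc a ha x).symm) (hcb.trans hba)
        exact absurd (this ▸ hc.1) (zero_notMem_of_ne_top hI1)
      · exact ha.2 h hba

theorem disjoint_minGens (hI1 : I ≠ ⊤)
    (hcop : ∀ a ∈ minGens I, ∀ b ∈ minGens J, ∀ x, a x = 0 ∨ b x = 0) :
    Disjoint (minGens I) (minGens J) := by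
  refine Set.disjoint_left.2 fun a ha hb => zero_notMem_of_ne_top hI1 ?_
  have : a = 0 := by
    ext x
    simpa using hcop a ha a hb x
  exact this ▸ ha.1

/-- The minimal generators of `I` together with those of `J` are the minimal generators of
`I + J`. -/
theorem exists_equiv_minGens_add (hI : IsMonomial I) (hJ : IsMonomial J) (hI1 : I ≠ ⊤)
    (hJ1 : J ≠ ⊤) (hcop : ∀ a ∈ minGens I, ∀ b ∈ minGens J, ∀ x, a x = 0 ∨ b x = 0) :
    ∃ e : minGens I ⊕ minGens J ≃ minGens (I + J),
      ∀ x, (e x : Fin n →₀ ℕ) = Sum.elim Subtype.val Subtype.val x := by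
  classical
  refine ⟨(Equiv.Set.union (disjoint_minGens hI1 hcop)).symm.trans
    (Equiv.setCongr (minGens_add_eq_union hI hJ hI1 hJ1 hcop).symm), ?_⟩
  rintro (x | x) <;> rfl

end Generators

/-! ### The Taylor differential on the sum of all homological degrees -/

section Total

variable {n : ℕ} {K : Type u} [Field K]

theorem finsupp_monomial_induction {α : Type*} {P : (α →₀ MvPolynomial (Fin n) K) → Prop}
    (x : α →₀ MvPolynomial (Fin n) K) (h0 : P 0) (hadd : ∀ x y, P x → P y → P (x + y))
    (hmon : ∀ s b c, P (Finsupp.single s (monomial b c))) : P x := by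
  induction x using Finsupp.induction_linear with
  | zero => exact h0
  | add x y hx hy => exact hadd x y hx hy
  | single s p =>
    induction p using MvPolynomial.induction_on' with
    | monomial b c => exact hmon s b c
    | add p q hp hq =>
      rw [Finsupp.single_add]
      exact hadd _ _ hp hq

variable {ι : Type} [LinearOrder ι]

variable (K) in
/-- The sign `(-1) ^ (k - 1)` of `j` relative to `S`, where `k - 1` is the number of elements
of `S` below `j`. -/
def sgn (j : ι) (S : Finset ι) : K := (-1) ^ (S.filter (· < j)).card

theorem sgn_mul_self (j : ι) (S : Finset ι) : sgn K j S * sgn K j S = 1 := by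
  rw [sgn, ← pow_add, ← two_mul, pow_mul]
  simp

theorem sgn_insert_self (j : ι) (S : Finset ι) : sgn K j (insert j S) = sgn K j S := by
  simp [sgn, Finset.filter_insert]

theorem sgn_eq_prod (j : ι) (S : Finset ι) :
    sgn K j S = ∏ a ∈ S, if a < j then (-1 : K) else 1 := by
  rw [Finset.prod_ite]
  simp [sgn]

/-- The form of `sign_swap` that makes the mixed terms of the contracting homotopy cancel. -/
theorem sgn_mul_sgn_insert_add {S : Finset ι} {j k : ι} (hj : j ∉ S) (hk : k ∈ S) :
    sgn K j S * sgn K k (insert j S) + sgn K k S * sgn K j (S.erase k) = 0 := by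
  have hjk : j ≠ k := fun h => hj (h ▸ hk)
  have h : sgn K j (insert j S) * sgn K k ((insert j S).erase j) +
      sgn K k (insert j S) * sgn K j ((insert j S).erase k) = 0 :=
    sign_swap K (insert j S) (Finset.mem_insert_self j S) (Finset.mem_insert_of_mem hk) hjk
  rw [sgn_insert_self, Finset.erase_insert hj, Finset.erase_insert_of_ne hjk,
    sgn_insert_self] at h
  linear_combination (sgn K k S * sgn K k (insert j S)) * h -
    (sgn K j S * sgn K k (insert j S)) * sgn_mul_self (K := K) k S -
    (sgn K k S * sgn K j (S.erase k)) * sgn_mul_self (K := K) k (insert j S)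

variable (K) (m : ι → Fin n →₀ ℕ)

/-- The Taylor differential on the free module with basis all symbols `e_S`. -/
def totalD : (Finset ι →₀ MvPolynomial (Fin n) K) →ₗ[MvPolynomial (Fin n) K]
    (Finset ι →₀ MvPolynomial (Fin n) K) :=
  Finsupp.linearCombination _ fun S => ∑ j ∈ S,
    Finsupp.single (S.erase j) (monomial (lcmExp m S - lcmExp m (S.erase j)) (sgn K j S))

variable (n ι) in
/-- The inclusion of the `i`-th module of the Taylor complex in the sum of all of them. -/
def incl (i : ℕ) : TaylorModule n K ι i →ₗ[MvPolynomial (Fin n) K]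
    (Finset ι →₀ MvPolynomial (Fin n) K) :=
  Finsupp.lmapDomain _ _ Subtype.val

omit [LinearOrder ι] in
theorem incl_injective (i : ℕ) : Function.Injective (incl n K ι i) :=
  Finsupp.mapDomain_injective Subtype.val_injective

omit [LinearOrder ι] in
@[simp]
theorem incl_single {i : ℕ} (S : {S : Finset ι // S.card = i}) (p : MvPolynomial (Fin n) K) :
    incl n K ι i (Finsupp.single S p) = Finsupp.single S.1 p :=
  Finsupp.mapDomain_single

theorem incl_d_single {i : ℕ} (S : {S : Finset ι // S.card = i + 1})
    (p : MvPolynomial (Fin n) K) :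
    incl n K ι i (d K m i (Finsupp.single S p)) = totalD K m (Finsupp.single S.1 p) := by
  simp only [d, totalD, dBasis, Finsupp.linearCombination_single, map_smul, map_sum, incl_single]
  congr 1
  exact Finset.sum_coe_sort S.1 fun j => Finsupp.single (S.1.erase j)
    (monomial (lcmExp m S.1 - lcmExp m (S.1.erase j)) (sgn K j S.1))

theorem incl_d {i : ℕ} (x : TaylorModule n K ι (i + 1)) :
    incl n K ι i (d K m i x) = totalD K m (incl n K ι (i + 1) x) := by
  induction x using Finsupp.induction_linear with
  | zero => simp
  | add x y hx hy => simp only [map_add, hx, hy]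
  | single S p => rw [incl_d_single, incl_single]

/-- The element `c x ^ (a - lcm S) e_S` of multidegree `a`; meaningful if `lcm S ≤ a`. -/
def homog (a : Fin n →₀ ℕ) (S : Finset ι) (c : K) : Finset ι →₀ MvPolynomial (Fin n) K :=
  Finsupp.single S (monomial (a - lcmExp m S) c)

theorem lcmExp_erase_le (S : Finset ι) (j : ι) : lcmExp m (S.erase j) ≤ lcmExp m S :=
  Finset.sup_mono (Finset.erase_subset _ _)

theorem totalD_homog {a : Fin n →₀ ℕ} {S : Finset ι} (h : lcmExp m S ≤ a) (c : K) :
    totalD K m (homog K m a S c) = ∑ j ∈ S, homog K m a (S.erase j) (c * sgn K j S) := by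
  simp only [totalD, homog, Finsupp.linearCombination_single, Finset.smul_sum,
    Finsupp.smul_single, smul_eq_mul, monomial_mul]
  refine Finset.sum_congr rfl fun j _ => ?_
  rw [tsub_add_tsub_cancel h (lcmExp_erase_le m S j)]

omit [LinearOrder ι] in
theorem single_eq_homog (b : Fin n →₀ ℕ) (S : Finset ι) (c : K) :
    Finsupp.single S (monomial b c) = homog K m (b + lcmExp m S) S c := by
  rw [homog, add_tsub_cancel_right]

/-! ### Exactness of the Taylor complex -/

open Classical in
/-- The value at `x ^ b e_S` of the contracting homotopy of the Taylor complex: in each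
multidegree `a` that is divisible by some `m_j`, one such `j` is chosen, and the homotopy is the
exterior multiplication by `e_j`. -/
def homotopyBasis (S : Finset ι) (b : Fin n →₀ ℕ) : Finset ι →₀ MvPolynomial (Fin n) K :=
  if h : ∃ j, m j ≤ b + lcmExp m S then
    if h.choose ∈ S then 0
    else homog K m (b + lcmExp m S) (insert h.choose S) (sgn K h.choose S)
  else 0

/-- The contracting homotopy of the Taylor complex, a `K`-linear map. -/
def homotopy : (Finset ι →₀ MvPolynomial (Fin n) K) →ₗ[K]
    (Finset ι →₀ MvPolynomial (Fin n) K) :=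
  Finsupp.lsum K fun S => (basisMonomials (Fin n) K).constr K (homotopyBasis K m S)

omit [LinearOrder ι] in
theorem smul_homog (a : Fin n →₀ ℕ) (S : Finset ι) (c c' : K) :
    c • homog K m a S c' = homog K m a S (c * c') := by
  rw [homog, homog, Finsupp.smul_single, smul_monomial, smul_eq_mul]

theorem homotopy_single (S : Finset ι) (b : Fin n →₀ ℕ) (c : K) :
    homotopy K m (Finsupp.single S (monomial b c)) = c • homotopyBasis K m S b := by
  have : monomial b c = c • basisMonomials (Fin n) K b := by
    rw [coe_basisMonomials, smul_monomial, smul_eq_mul, mul_one]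
  rw [homotopy, Finsupp.lsum_single, this, map_smul, Module.Basis.constr_basis]

theorem exists_homotopy_homog {a : Fin n →₀ ℕ} (ha : ∃ j, m j ≤ a) :
    ∃ j, m j ≤ a ∧ ∀ (S : Finset ι) (c : K), lcmExp m S ≤ a →
      homotopy K m (homog K m a S c) =
        if j ∈ S then 0 else homog K m a (insert j S) (c * sgn K j S) := by
  refine ⟨ha.choose, ha.choose_spec, fun S c hS => ?_⟩
  obtain ⟨b, rfl⟩ : ∃ b, a = b + lcmExp m S := ⟨a - lcmExp m S, (tsub_add_cancel_of_le hS).symm⟩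
  rw [← single_eq_homog, homotopy_single, homotopyBasis, dif_pos ha, smul_ite, smul_zero,
    smul_homog]

theorem totalD_homotopy_add {a : Fin n →₀ ℕ} (ha : ∃ j, m j ≤ a) {S : Finset ι}
    (hS : lcmExp m S ≤ a) (c : K) :
    totalD K m (homotopy K m (homog K m a S c)) + homotopy K m (totalD K m (homog K m a S c)) =
      homog K m a S c := by
  obtain ⟨j, hj, H⟩ := exists_homotopy_homog K m ha
  have hle : ∀ k, lcmExp m (S.erase k) ≤ a := fun k => (lcmExp_erase_le m S k).trans hS
  rw [H S c hS, totalD_homog K m hS, map_sum, Finset.sum_congr rfl fun k _ => H _ _ (hle k)]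
  by_cases hjS : j ∈ S
  · rw [if_pos hjS, map_zero, zero_add, Finset.sum_eq_single_of_mem j hjS]
    · have h1 : sgn K j (S.erase j) = sgn K j S := by
        rw [← sgn_insert_self, Finset.insert_erase hjS]
      rw [if_neg (Finset.notMem_erase j S), Finset.insert_erase hjS, h1, mul_assoc,
        sgn_mul_self, mul_one]
    · intro k _ hkj
      exact if_pos (Finset.mem_erase.2 ⟨hkj.symm, hjS⟩)
  · have hins : lcmExp m (insert j S) ≤ a := by
      rw [lcmExp, Finset.sup_insert]
      exact sup_le hj hS
    rw [if_neg hjS, totalD_homog K m hins, Finset.sum_insert hjS, Finset.erase_insert hjS,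
      sgn_insert_self, mul_assoc, sgn_mul_self, mul_one, add_assoc, ← Finset.sum_add_distrib,
      Finset.sum_eq_zero, add_zero]
    intro k hk
    have hjk : j ≠ k := fun h => hjS (h ▸ hk)
    rw [if_neg fun h => hjS (Finset.mem_of_mem_erase h), Finset.erase_insert_of_ne hjk, homog,
      homog, ← Finsupp.single_add, ← map_add, mul_assoc, mul_assoc, ← mul_add,
      sgn_mul_sgn_insert_add hjS hk, mul_zero, map_zero, Finsupp.single_zero]

theorem totalD_homotopy_incl {i : ℕ} (x : TaylorModule n K ι (i + 1)) :
    totalD K m (homotopy K m (incl n K ι _ x)) + homotopy K m (totalD K m (incl n K ι _ x)) =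
      incl n K ι _ x := by
  induction x using finsupp_monomial_induction with
  | h0 => simp
  | hadd x y hx hy =>
    conv_rhs => rw [map_add, ← hx, ← hy]
    simp only [map_add]
    abel
  | hmon S b c =>
    rw [incl_single, single_eq_homog K m]
    obtain ⟨j, hj⟩ : S.1.Nonempty := Finset.card_pos.1 (by rw [S.2]; exact Nat.succ_pos i)
    exact totalD_homotopy_add K m ⟨j, (Finset.le_sup hj).trans le_add_self⟩ le_add_self c

theorem exists_incl_eq_homotopy {i : ℕ} (x : TaylorModule n K ι i) :
    ∃ y : TaylorModule n K ι (i + 1), incl n K ι _ y = homotopy K m (incl n K ι _ x) := by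
  induction x using finsupp_monomial_induction with
  | h0 => exact ⟨0, by simp⟩
  | hadd x y hx hy =>
    obtain ⟨x', hx⟩ := hx
    obtain ⟨y', hy⟩ := hy
    exact ⟨x' + y', by simp only [map_add, hx, hy]⟩
  | hmon S b c =>
    rw [incl_single, homotopy_single, homotopyBasis]
    split_ifs with h1 h2
    · exact ⟨0, by simp⟩
    · refine ⟨Finsupp.single ⟨insert h1.choose S.1, by rw [Finset.card_insert_of_notMem h2, S.2]⟩
        (monomial (b + lcmExp m S.1 - lcmExp m (insert h1.choose S.1))
          (c * sgn K h1.choose S.1)), ?_⟩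
      rw [incl_single, smul_homog]
      rfl
    · exact ⟨0, by simp⟩

theorem exists_d_eq_of_d_eq_zero {i : ℕ} (x : TaylorModule n K ι (i + 1)) (hx : d K m i x = 0) :
    ∃ y, d K m (i + 1) y = x := by
  obtain ⟨y, hy⟩ := exists_incl_eq_homotopy K m x
  refine ⟨y, incl_injective K _ ?_⟩
  have h := totalD_homotopy_incl K m x
  rwa [← incl_d, hx, map_zero, map_zero, add_zero, ← hy, ← incl_d] at h

theorem taylorOfFamily_d (i : ℕ) :
    (taylorOfFamily K m).d (i + 1) i = ModuleCat.ofHom (d K m i) :=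
  ChainComplex.of_d (fun i => ModuleCat.of _ (TaylorModule n K ι i))
    (fun i => ModuleCat.ofHom (d K m i)) i

theorem taylorOfFamily_exactAt {r : ℕ} (hr : 1 ≤ r) : (taylorOfFamily K m).ExactAt r := by
  obtain ⟨i, rfl⟩ := Nat.exists_eq_add_of_le' hr
  rw [HomologicalComplex.exactAt_iff' _ (i + 1 + 1) (i + 1) i (by simp) (by simp),
    ShortComplex.moduleCat_exact_iff]
  intro x hx
  rw [HomologicalComplex.shortComplexFunctor'_obj_g, taylorOfFamily_d] at hx
  rw [HomologicalComplex.shortComplexFunctor'_obj_f, taylorOfFamily_d]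
  exact exists_d_eq_of_d_eq_zero K m x hx

/-! ### The homology of the Taylor complex in degree zero -/

theorem d_zero_single (j : ι) (S : {S : Finset ι // S.card = 0}) :
    d K m 0 (Finsupp.single ⟨{j}, Finset.card_singleton j⟩ 1) =
      Finsupp.single S (monomial (m j) 1) := by
  refine incl_injective K _ ?_
  have hS : S.1 = ∅ := Finset.card_eq_zero.1 S.2
  rw [incl_d_single, incl_single, hS, totalD, Finsupp.linearCombination_single,
    Finset.sum_singleton]
  simp [sgn, Finset.filter_singleton, lcmExp, bot_eq_zero]

/-- The image of the first step of the Taylor complex is the ideal of the monomials `m_j`, under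
the identification of its module of degree zero with the polynomial ring. -/
theorem exists_linearEquiv_range_d_zero : ∃ e : TaylorModule n K ι 0 ≃ₗ[MvPolynomial (Fin n) K]
    MvPolynomial (Fin n) K, (LinearMap.range (d K m 0)).map e.toLinearMap =
      Ideal.span ((fun a => monomial a (1 : K)) '' Set.range m) := by
  let S₀ : {S : Finset ι // S.card = 0} := ⟨∅, rfl⟩
  have : Subsingleton {S : Finset ι // S.card = 0} :=
    ⟨fun S T => Subtype.ext ((Finset.card_eq_zero.1 S.2).trans (Finset.card_eq_zero.1 T.2).symm)⟩
  let e := Finsupp.uniqueLinearEquiv (MvPolynomial (Fin n) K) (MvPolynomial (Fin n) K) S₀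
  have he : ∀ j, e (d K m 0 (Finsupp.single ⟨{j}, Finset.card_singleton j⟩ 1)) =
      monomial (m j) 1 := fun j => by
    rw [d_zero_single K m j S₀]
    simp [e]
  refine ⟨e, ?_⟩
  rw [d, Finsupp.range_linearCombination, Submodule.map_span, Ideal.span]
  congr 1
  have hd : ∀ j, dBasis K m 0 ⟨{j}, Finset.card_singleton j⟩ =
      d K m 0 (Finsupp.single ⟨{j}, Finset.card_singleton j⟩ 1) := fun j => by
    rw [d, Finsupp.linearCombination_single, one_smul]
  ext p
  constructor
  · rintro ⟨_, ⟨S, rfl⟩, rfl⟩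
    obtain ⟨j, hj⟩ := Finset.card_eq_one.1 S.2
    obtain rfl : S = ⟨{j}, Finset.card_singleton j⟩ := Subtype.ext hj
    exact ⟨m j, ⟨j, rfl⟩, by rw [hd]; exact (he j).symm⟩
  · rintro ⟨_, ⟨j, rfl⟩, rfl⟩
    exact ⟨_, ⟨⟨{j}, Finset.card_singleton j⟩, rfl⟩, by rw [hd]; exact he j⟩

theorem nonempty_homology_zero_iso :
    Nonempty ((taylorOfFamily K m).homology 0 ≅ ModuleCat.of (MvPolynomial (Fin n) K)
      (MvPolynomial (Fin n) K ⧸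
        Ideal.span ((fun a => monomial a (1 : K)) '' Set.range m))) := by
  obtain ⟨e, he⟩ := exists_linearEquiv_range_d_zero K m
  have hg : ((taylorOfFamily K m).sc' 1 0 0).g = 0 :=
    (taylorOfFamily K m).shape _ _ (by simp)
  have hf : ((taylorOfFamily K m).sc' 1 0 0).f = ModuleCat.ofHom (d K m 0) :=
    taylorOfFamily_d K m 0
  refine ⟨(taylorOfFamily K m).homologyIsoSc' 1 0 0 (by simp) (by simp) ≪≫
    (ShortComplex.LeftHomologyData.ofIsColimitCokernelCofork _ hg _
      (ModuleCat.cokernelIsColimit _)).homologyIso ≪≫ LinearEquiv.toModuleIso ?_⟩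
  refine Submodule.Quotient.equiv _ _ e ?_
  rw [hf]
  exact he

end Total

/-! ### Independence of the order on the generators -/

section Reindex

variable {n : ℕ} {K : Type u} [Field K] {ι ι' : Type} [LinearOrder ι] [LinearOrder ι']
  (σ : ι ≃ ι')

variable (K) in
/-- The sign of the permutation that `σ` induces on the elements of `S`, as a product over the
pairs of elements of `S`, each inversion contributing a factor `-1`. -/
def reindexSign (S : Finset ι) : K :=
  ∏ a ∈ S, ∏ b ∈ S, if a < b ∧ σ b < σ a then -1 else 1

theorem reindexSign_mul_self (S : Finset ι) : reindexSign K σ S * reindexSign K σ S = 1 := by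
  simp only [reindexSign, ← Finset.prod_mul_distrib]
  refine Finset.prod_eq_one fun a _ => Finset.prod_eq_one fun b _ => ?_
  split_ifs <;> simp

theorem reindexSign_insert_mul_sgn {j : ι} {S : Finset ι} (hj : j ∉ S) :
    reindexSign K σ (insert j S) * sgn K (σ j) (S.map σ.toEmbedding) =
      reindexSign K σ S * sgn K j S := by
  simp only [reindexSign, Finset.prod_insert hj, sgn_eq_prod, Finset.prod_map,
    Finset.prod_mul_distrib, Equiv.coe_toEmbedding, lt_self_iff_false, false_and, if_false,
    one_mul]
  -- each `a` in `S` contributes the same sign to both sides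
  have h : (∏ b ∈ S, if j < b ∧ σ b < σ j then (-1 : K) else 1) *
      (∏ a ∈ S, if a < j ∧ σ j < σ a then (-1 : K) else 1) *
      (∏ a ∈ S, if σ a < σ j then (-1 : K) else 1) = ∏ a ∈ S, if a < j then (-1 : K) else 1 := by
    simp only [← Finset.prod_mul_distrib]
    refine Finset.prod_congr rfl fun a ha => ?_
    have haj : a ≠ j := fun h => hj (h ▸ ha)
    have hσ : σ a ≠ σ j := fun h => haj (σ.injective h)
    rcases lt_or_gt_of_ne haj with h1 | h1 <;> rcases lt_or_gt_of_ne hσ with h2 | h2 <;>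
      simp [h1, h2, h1.not_gt, h2.not_gt]
  rw [← h]
  ring

theorem reindexSign_mul_sgn {j : ι} {S : Finset ι} (hj : j ∈ S) :
    reindexSign K σ S * sgn K (σ j) (S.map σ.toEmbedding) =
      sgn K j S * reindexSign K σ (S.erase j) := by
  have h := reindexSign_insert_mul_sgn (K := K) σ (Finset.notMem_erase j S)
  rw [Finset.insert_erase hj, ← sgn_insert_self (σ j), ← sgn_insert_self j (S.erase j),
    Finset.insert_erase hj] at h
  rw [mul_comm (sgn K j S), ← h, ← Equiv.coe_toEmbedding, ← Finset.map_insert,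
    Finset.insert_erase hj]

/-- The bijection that `σ` induces between the subsets of `i` elements. -/
def mapFinset (i : ℕ) (S : {S : Finset ι // S.card = i}) : {S : Finset ι' // S.card = i} :=
  ⟨S.1.map σ.toEmbedding, by rw [Finset.card_map, S.2]⟩

omit [LinearOrder ι] [LinearOrder ι'] in
theorem mapFinset_symm_mapFinset (i : ℕ) (S : {S : Finset ι // S.card = i}) :
    mapFinset σ.symm i (mapFinset σ i S) = S := by
  refine Subtype.ext ?_
  ext
  simp [mapFinset]

omit [LinearOrder ι] [LinearOrder ι'] in
theorem mapFinset_mapFinset_symm (i : ℕ) (S : {S : Finset ι' // S.card = i}) :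
    mapFinset σ i (mapFinset σ.symm i S) = S :=
  mapFinset_symm_mapFinset σ.symm i S

variable (n K) in
/-- The isomorphism of Taylor modules that sends `e_S` to `± e_{σ(S)}`. -/
def reindexEquiv (i : ℕ) :
    TaylorModule n K ι i ≃ₗ[MvPolynomial (Fin n) K] TaylorModule n K ι' i :=
  LinearEquiv.ofLinearMap
    (Finsupp.linearCombination _ fun S =>
      Finsupp.single (mapFinset σ i S) (C (reindexSign K σ S.1)))
    (Finsupp.linearCombination _ fun S =>
      Finsupp.single (mapFinset σ.symm i S) (C (reindexSign K σ (mapFinset σ.symm i S).1)))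
    (by
      refine Finsupp.lhom_ext' fun S => LinearMap.ext_ring ?_
      simp [mapFinset_mapFinset_symm, ← C_mul, reindexSign_mul_self])
    (by
      refine Finsupp.lhom_ext' fun S => LinearMap.ext_ring ?_
      simp [mapFinset_symm_mapFinset, ← C_mul, reindexSign_mul_self])

theorem reindexEquiv_single (i : ℕ) (S : {S : Finset ι // S.card = i})
    (p : MvPolynomial (Fin n) K) :
    reindexEquiv n K σ i (Finsupp.single S p) =
      Finsupp.single (mapFinset σ i S) (p * C (reindexSign K σ S.1)) := by
  change Finsupp.linearCombination _ _ _ = _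
  rw [Finsupp.linearCombination_single, Finsupp.smul_single, smul_eq_mul]

theorem reindexEquiv_symm_single (i : ℕ) (S : {S : Finset ι' // S.card = i})
    (p : MvPolynomial (Fin n) K) :
    (reindexEquiv n K σ i).symm (Finsupp.single S p) =
      Finsupp.single (mapFinset σ.symm i S)
        (p * C (reindexSign K σ (mapFinset σ.symm i S).1)) := by
  change Finsupp.linearCombination _ _ _ = _
  rw [Finsupp.linearCombination_single, Finsupp.smul_single, smul_eq_mul]

variable {m : ι → Fin n →₀ ℕ} {m' : ι' → Fin n →₀ ℕ} (hm : ∀ j, m' (σ j) = m j)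

omit [LinearOrder ι] [LinearOrder ι'] in
include hm in
theorem lcmExp_map (S : Finset ι) : lcmExp m' (S.map σ.toEmbedding) = lcmExp m S := by
  rw [lcmExp, Finset.sup_map]
  exact Finset.sup_congr rfl fun j _ => hm j

include hm in
theorem d_reindexEquiv (i : ℕ) (x : TaylorModule n K ι (i + 1)) :
    d K m' i (reindexEquiv n K σ (i + 1) x) = reindexEquiv n K σ i (d K m i x) := by
  induction x using Finsupp.induction_linear with
  | zero => simp
  | add x y hx hy => simp only [map_add, hx, hy]
  | single S p =>
    refine incl_injective K _ ?_
    have h : ∀ j : {j // j ∈ S.1},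
        (mapFinset σ i ⟨S.1.erase j.1, by rw [Finset.card_erase_of_mem j.2, S.2]; rfl⟩).1 =
          (S.1.map σ.toEmbedding).erase (σ j) := fun j =>
      Finset.map_erase σ.toEmbedding S.1 j
    rw [reindexEquiv_single, incl_d_single, totalD, Finsupp.linearCombination_single, d,
      Finsupp.linearCombination_single, dBasis]
    simp only [map_smul, map_sum, reindexEquiv_single, incl_single, h]
    rw [mul_smul]
    congr 1
    change _ • ∑ j ∈ S.1.map σ.toEmbedding, _ = _
    rw [Finset.sum_map, Finset.smul_sum, ← Finset.sum_coe_sort]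
    refine Finset.sum_congr rfl fun j _ => ?_
    have hmap : lcmExp m' ((S.1.map σ.toEmbedding).erase (σ j)) = lcmExp m (S.1.erase j.1) := by
      rw [← lcmExp_map σ hm, Finset.map_erase, Equiv.coe_toEmbedding]
    simp only [mapFinset, Equiv.coe_toEmbedding, hmap, lcmExp_map σ hm, Finsupp.smul_single,
      smul_eq_mul, C_mul_monomial]
    rw [mul_comm (monomial _ _), C_mul_monomial, reindexSign_mul_sgn σ j.2, mul_comm]
    rfl

/-- The Taylor complexes of two families of monomials that differ by a bijection of the index
sets are isomorphic, whatever the orders on these sets. -/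
def reindexIso : taylorOfFamily K m ≅ taylorOfFamily K m' :=
  HomologicalComplex.Hom.isoOfComponents (fun i => (reindexEquiv n K σ i).toModuleIso) (by
    rintro i j (rfl : j + 1 = i)
    rw [taylorOfFamily_d, taylorOfFamily_d]
    ext1
    exact LinearMap.ext fun x => d_reindexEquiv σ hm j x)

theorem single_mem_taylorOfFamilyDeg {i : ℕ} {a : Fin n →₀ ℕ} (S : {S : Finset ι // S.card = i})
    (b : Fin n →₀ ℕ) (c : K) (h : b + lcmExp m S.1 = a) :
    (Finsupp.single S (monomial b c) : TaylorModule n K ι i) ∈ taylorOfFamilyDeg K m i a :=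
  AddSubgroup.subset_closure ⟨S, b, c, h, rfl⟩

/-- A homomorphism maps the component of multidegree `a` of a Taylor module into a subgroup if it
does so with the terms of multidegree `a`. -/
theorem map_mem_of_mem_taylorOfFamilyDeg {i : ℕ} {a : Fin n →₀ ℕ} {A : Type*} [AddGroup A]
    (f : TaylorModule n K ι i →+ A) (H : AddSubgroup A)
    (hf : ∀ S b c, b + lcmExp m S.1 = a → f (Finsupp.single S (monomial b c)) ∈ H)
    {x : TaylorModule n K ι i} (hx : x ∈ taylorOfFamilyDeg K m i a) : f x ∈ H := by
  refine (AddSubgroup.closure_le (H.comap f)).2 ?_ hx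
  rintro _ ⟨S, b, c, h, rfl⟩
  exact hf S b c h

include hm in
theorem reindexEquiv_mem_iff (i : ℕ) (a : Fin n →₀ ℕ) (x : TaylorModule n K ι i) :
    reindexEquiv n K σ i x ∈ taylorOfFamilyDeg K m' i a ↔ x ∈ taylorOfFamilyDeg K m i a := by
  constructor
  · intro h
    rw [← (reindexEquiv n K σ i).symm_apply_apply x]
    refine map_mem_of_mem_taylorOfFamilyDeg
      (reindexEquiv n K σ i).symm.toLinearMap.toAddMonoidHom _ (fun S b c hb => ?_) h
    change (reindexEquiv n K σ i).symm _ ∈ _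
    rw [reindexEquiv_symm_single, mul_comm, C_mul_monomial]
    refine single_mem_taylorOfFamilyDeg _ _ _ ?_
    rw [← hb, ← lcmExp_map σ hm]
    congr 2
    exact congrArg Subtype.val (mapFinset_mapFinset_symm σ i S)
  · refine map_mem_of_mem_taylorOfFamilyDeg
      (reindexEquiv n K σ i).toLinearMap.toAddMonoidHom _ fun S b c hb => ?_
    change reindexEquiv n K σ i _ ∈ _
    rw [reindexEquiv_single, mul_comm, C_mul_monomial]
    refine single_mem_taylorOfFamilyDeg _ _ _ ?_
    rw [← hb, ← lcmExp_map σ hm]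
    rfl

end Reindex

/-! ### The tensor product of the Taylor complexes of two coprime families -/

section Tensor

variable {n : ℕ} {K : Type u} [Field K] {ι₁ ι₂ ι : Type} (σ : ι₁ ⊕ ι₂ ≃ ι)

/-- The subset of `ι` that corresponds to `S ⊆ ι₁` and `T ⊆ ι₂` under `σ : ι₁ ⊕ ι₂ ≃ ι`. -/
def join (S : Finset ι₁) (T : Finset ι₂) : Finset ι := (S.disjSum T).map σ.toEmbedding

theorem card_join (S : Finset ι₁) (T : Finset ι₂) : (join σ S T).card = S.card + T.card := by
  rw [join, Finset.card_map, Finset.card_disjSum]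

/-- The part of `U ⊆ ι` that comes from `ι₁`. -/
def leftPart (U : Finset ι) : Finset ι₁ := (U.map σ.symm.toEmbedding).toLeft

/-- The part of `U ⊆ ι` that comes from `ι₂`. -/
def rightPart (U : Finset ι) : Finset ι₂ := (U.map σ.symm.toEmbedding).toRight

theorem leftPart_join (S : Finset ι₁) (T : Finset ι₂) : leftPart σ (join σ S T) = S := by
  ext
  simp [leftPart, join]

theorem rightPart_join (S : Finset ι₁) (T : Finset ι₂) : rightPart σ (join σ S T) = T := by
  ext
  simp [rightPart, join]

theorem join_leftPart_rightPart (U : Finset ι) : join σ (leftPart σ U) (rightPart σ U) = U := by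
  rw [join, leftPart, rightPart, Finset.toLeft_disjSum_toRight]
  ext
  simp

theorem card_leftPart_add_card_rightPart (U : Finset ι) :
    (leftPart σ U).card + (rightPart σ U).card = U.card := by
  rw [← card_join σ, join_leftPart_rightPart]

theorem sum_join {A : Type*} [AddCommMonoid A] (S : Finset ι₁) (T : Finset ι₂) (f : ι → A) :
    ∑ x ∈ join σ S T, f x = ∑ a ∈ S, f (σ (.inl a)) + ∑ b ∈ T, f (σ (.inr b)) := by
  rw [join, Finset.sum_map, Finset.sum_disjSum]
  rfl

theorem prod_join {A : Type*} [CommMonoid A] (S : Finset ι₁) (T : Finset ι₂) (f : ι → A) :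
    ∏ x ∈ join σ S T, f x = (∏ a ∈ S, f (σ (.inl a))) * ∏ b ∈ T, f (σ (.inr b)) := by
  rw [join, Finset.prod_map, Finset.prod_disjSum]
  rfl

variable {m₁ : ι₁ → Fin n →₀ ℕ} {m₂ : ι₂ → Fin n →₀ ℕ} {m : ι → Fin n →₀ ℕ}

theorem coprime_lcmExp (hcop : ∀ a b x, m₁ a x = 0 ∨ m₂ b x = 0) (S : Finset ι₁) (T : Finset ι₂)
    (x : Fin n) : lcmExp m₁ S x = 0 ∨ lcmExp m₂ T x = 0 := by
  have h1 : ∀ {α : Type} (f : α → Fin n →₀ ℕ) (S : Finset α),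
      (∀ a, f a x = 0) → lcmExp f S x = 0 := fun f S h => by
    refine Finset.sup_induction (p := fun y : Fin n →₀ ℕ => y x = 0) rfl
      (fun a ha b hb => ?_) fun a _ => h a
    rw [Finsupp.sup_apply, ha, hb, max_self]
  by_cases h : ∀ a, m₁ a x = 0
  · exact Or.inl (h1 _ S h)
  · push Not at h
    obtain ⟨a, ha⟩ := h
    exact Or.inr (h1 _ T fun b => (hcop a b x).resolve_left ha)

/-- Coprimality turns the lcm of the two parts into their product. -/
theorem lcmExp_join (hm : ∀ x, m (σ x) = Sum.elim m₁ m₂ x)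
    (hcop : ∀ a b x, m₁ a x = 0 ∨ m₂ b x = 0) (S : Finset ι₁) (T : Finset ι₂) :
    lcmExp m (join σ S T) = lcmExp m₁ S + lcmExp m₂ T := by
  have h : lcmExp m (join σ S T) = lcmExp m₁ S ⊔ lcmExp m₂ T := by
    refine eq_of_forall_ge_iff fun c => ?_
    simp only [lcmExp, join, Finset.sup_map, sup_le_iff, Finset.sup_le_iff, Sum.forall,
      Finset.inl_mem_disjSum, Finset.inr_mem_disjSum, Function.comp_apply, Equiv.coe_toEmbedding,
      hm, Sum.elim_inl, Sum.elim_inr]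
  rw [h]
  ext x
  have := coprime_lcmExp hcop S T x
  rw [Finsupp.sup_apply, Finsupp.add_apply]
  omega

variable (n K) in
/-- The map `e_S ⊗ e_T ↦ e_{S ∪ T}` on the sum of all homological degrees, as a bilinear
map. -/
def totalJoin : (Finset ι₁ →₀ MvPolynomial (Fin n) K) →ₗ[MvPolynomial (Fin n) K]
    (Finset ι₂ →₀ MvPolynomial (Fin n) K) →ₗ[MvPolynomial (Fin n) K]
      (Finset ι →₀ MvPolynomial (Fin n) K) :=
  Finsupp.linearCombination _ fun S =>
    Finsupp.linearCombination _ fun T => Finsupp.single (join σ S T) 1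

theorem totalJoin_single (S : Finset ι₁) (T : Finset ι₂) (p q : MvPolynomial (Fin n) K) :
    totalJoin n K σ (Finsupp.single S p) (Finsupp.single T q) =
      Finsupp.single (join σ S T) (p * q) := by
  simp [totalJoin]

variable (n K) in
/-- The map `e_S ⊗ e_T ↦ e_{S ∪ T}` in homological degrees `i + j = r`. -/
def joinMap (i j r : ℕ) (h : i + j = r) :
    TaylorModule n K ι₁ i ⊗[MvPolynomial (Fin n) K] TaylorModule n K ι₂ j
      →ₗ[MvPolynomial (Fin n) K] TaylorModule n K ι r :=
  TensorProduct.lift <| Finsupp.linearCombination _ fun S =>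
    Finsupp.linearCombination _ fun T =>
      Finsupp.single ⟨join σ S.1 T.1, by rw [card_join, S.2, T.2, h]⟩ 1

theorem joinMap_single {i j r : ℕ} (h : i + j = r) (S : {S : Finset ι₁ // S.card = i})
    (T : {T : Finset ι₂ // T.card = j}) (p q : MvPolynomial (Fin n) K) :
    joinMap n K σ i j r h (Finsupp.single S p ⊗ₜ Finsupp.single T q) =
      Finsupp.single ⟨join σ S.1 T.1, by rw [card_join, S.2, T.2, h]⟩ (p * q) := by
  simp [joinMap]

theorem incl_joinMap {i j r : ℕ} (h : i + j = r) (x : TaylorModule n K ι₁ i)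
    (y : TaylorModule n K ι₂ j) :
    incl n K ι r (joinMap n K σ i j r h (x ⊗ₜ y)) =
      totalJoin n K σ (incl n K ι₁ i x) (incl n K ι₂ j y) := by
  induction x using Finsupp.induction_linear with
  | zero => simp
  | add x x' hx hx' => simp only [map_add, TensorProduct.add_tmul, hx, hx', LinearMap.add_apply]
  | single S p =>
    induction y using Finsupp.induction_linear with
    | zero => simp
    | add y y' hy hy' => simp only [map_add, TensorProduct.tmul_add, hy, hy']
    | single T q => simp only [joinMap_single, incl_single, totalJoin_single]

variable [LinearOrder ι₁] [LinearOrder ι₂] [LinearOrder ι]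

omit [LinearOrder ι₂] in
theorem sgn_join_inl (hl : ∀ a b, σ (.inl a) < σ (.inl b) ↔ a < b)
    (hlr : ∀ a b, σ (.inl a) < σ (.inr b)) (S : Finset ι₁) (T : Finset ι₂) (j : ι₁) :
    sgn K (σ (.inl j)) (join σ S T) = sgn K j S := by
  simp only [sgn_eq_prod, prod_join, hl, (hlr _ _).not_gt, if_false, Finset.prod_const_one,
    mul_one]

omit [LinearOrder ι₁] in
theorem sgn_join_inr (hr : ∀ a b, σ (.inr a) < σ (.inr b) ↔ a < b)
    (hlr : ∀ a b, σ (.inl a) < σ (.inr b)) (S : Finset ι₁) (T : Finset ι₂) (j : ι₂) :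
    sgn K (σ (.inr j)) (join σ S T) = (-1) ^ S.card * sgn K j T := by
  simp only [sgn_eq_prod, prod_join, hr, hlr, if_true, Finset.prod_const]

omit [LinearOrder ι₂] in
theorem join_erase_inl (S : Finset ι₁) (T : Finset ι₂) (j : ι₁) :
    (join σ S T).erase (σ (.inl j)) = join σ (S.erase j) T := by
  ext x
  obtain ⟨x | x, rfl⟩ := σ.surjective x <;> simp [join]

omit [LinearOrder ι₁] in
theorem join_erase_inr (S : Finset ι₁) (T : Finset ι₂) (j : ι₂) :
    (join σ S T).erase (σ (.inr j)) = join σ S (T.erase j) := by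
  ext x
  obtain ⟨x | x, rfl⟩ := σ.surjective x <;> simp [join]

/-- The Leibniz rule for `e_S ⊗ e_T ↦ e_{S ∪ T}`. Coprimality enters through
`lcm (S ∪ T) = lcm S * lcm T`, which makes the coefficients of the two sides agree. -/
theorem totalD_totalJoin_single (hl : ∀ a b, σ (.inl a) < σ (.inl b) ↔ a < b)
    (hr : ∀ a b, σ (.inr a) < σ (.inr b) ↔ a < b) (hlr : ∀ a b, σ (.inl a) < σ (.inr b))
    (hm : ∀ x, m (σ x) = Sum.elim m₁ m₂ x) (hcop : ∀ a b x, m₁ a x = 0 ∨ m₂ b x = 0)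
    (S : Finset ι₁) (T : Finset ι₂) (p q : MvPolynomial (Fin n) K) :
    totalD K m (totalJoin n K σ (Finsupp.single S p) (Finsupp.single T q)) =
      totalJoin n K σ (totalD K m₁ (Finsupp.single S p)) (Finsupp.single T q) +
        (-1 : MvPolynomial (Fin n) K) ^ S.card •
          totalJoin n K σ (Finsupp.single S p) (totalD K m₂ (Finsupp.single T q)) := by
  simp only [totalJoin_single, totalD, Finsupp.linearCombination_single, sum_join,
    map_sum, LinearMap.sum_apply, smul_add, join_erase_inl,
    join_erase_inr, lcmExp_join σ hm hcop, add_tsub_add_eq_tsub_right,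
    add_tsub_add_eq_tsub_left, sgn_join_inl σ hl hlr, sgn_join_inr σ hr hlr, Finset.smul_sum,
    Finsupp.smul_single, smul_eq_mul]
  congr 1
  · refine Finset.sum_congr rfl fun j _ => ?_
    congr 1
    ring
  · refine Finset.sum_congr rfl fun j _ => ?_
    rw [← C_mul_monomial]
    simp only [map_pow, map_neg, map_one]
    congr 1
    ring

theorem totalD_totalJoin_incl (hl : ∀ a b, σ (.inl a) < σ (.inl b) ↔ a < b)
    (hr : ∀ a b, σ (.inr a) < σ (.inr b) ↔ a < b) (hlr : ∀ a b, σ (.inl a) < σ (.inr b))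
    (hm : ∀ x, m (σ x) = Sum.elim m₁ m₂ x) (hcop : ∀ a b x, m₁ a x = 0 ∨ m₂ b x = 0)
    {i j : ℕ} (x : TaylorModule n K ι₁ i) (y : TaylorModule n K ι₂ j) :
    totalD K m (totalJoin n K σ (incl n K ι₁ i x) (incl n K ι₂ j y)) =
      totalJoin n K σ (totalD K m₁ (incl n K ι₁ i x)) (incl n K ι₂ j y) +
        (-1 : MvPolynomial (Fin n) K) ^ i •
          totalJoin n K σ (incl n K ι₁ i x) (totalD K m₂ (incl n K ι₂ j y)) := by
  induction x using Finsupp.induction_linear with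
  | zero => simp
  | add x x' hx hx' =>
    simp only [map_add, LinearMap.add_apply, hx, hx', smul_add]
    abel
  | single S p =>
    induction y using Finsupp.induction_linear with
    | zero => simp
    | add y y' hy hy' =>
      simp only [map_add, hy, hy', smul_add]
      abel
    | single T q =>
      rw [incl_single, incl_single, totalD_totalJoin_single σ hl hr hlr hm hcop, S.2]

theorem totalD_incl_zero (m : ι → Fin n →₀ ℕ) (x : TaylorModule n K ι 0) :
    totalD K m (incl n K ι 0 x) = 0 := by
  induction x using Finsupp.induction_linear with
  | zero => simp
  | add x y hx hy => simp only [map_add, hx, hy, add_zero]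
  | single S p =>
    rw [incl_single, Finset.card_eq_zero.1 S.2, totalD, Finsupp.linearCombination_single,
      Finset.sum_empty, smul_zero]

variable (K m₁ m₂ m)

/-- The inclusion of the summand `T(m₁)_i ⊗ T(m₂)_j` in the tensor product of the Taylor
complexes, on the underlying modules. -/
def ιTaylor (i j r : ℕ) (h : i + j = r) :
    TaylorModule n K ι₁ i ⊗[MvPolynomial (Fin n) K] TaylorModule n K ι₂ j
      →ₗ[MvPolynomial (Fin n) K]
        (HomologicalComplex.tensorObj (taylorOfFamily K m₁) (taylorOfFamily K m₂)).X r :=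
  (HomologicalComplex.ιTensorObj (taylorOfFamily K m₁) (taylorOfFamily K m₂) i j r h).hom

variable {K m₁ m₂} in
theorem hom_ext_ιTaylor {r : ℕ} {M : Type u} [AddCommGroup M] [Module (MvPolynomial (Fin n) K) M]
    {f g : (HomologicalComplex.tensorObj (taylorOfFamily K m₁) (taylorOfFamily K m₂)).X r
      →ₗ[MvPolynomial (Fin n) K] M}
    (h : ∀ i j (h : i + j = r) x y,
      f (ιTaylor K m₁ m₂ i j r h (x ⊗ₜ y)) = g (ιTaylor K m₁ m₂ i j r h (x ⊗ₜ y))) : f = g := by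
  have : ModuleCat.ofHom f = ModuleCat.ofHom g := by
    refine HomologicalComplex.mapBifunctor.hom_ext fun i j hij => ?_
    ext1
    exact TensorProduct.ext' fun x y => h i j hij x y
  exact congrArg ModuleCat.Hom.hom this

/-- The map from the tensor product of the Taylor complexes given by `e_S ⊗ e_T ↦ e_{S ∪ T}`, in
homological degree `r`. -/
def tensorToTaylor (r : ℕ) :
    (HomologicalComplex.tensorObj (taylorOfFamily K m₁) (taylorOfFamily K m₂)).X r
      →ₗ[MvPolynomial (Fin n) K] TaylorModule n K ι r :=
  (HomologicalComplex.mapBifunctorDesc (A := ModuleCat.of _ (TaylorModule n K ι r))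
    fun i j h => ModuleCat.ofHom (joinMap n K σ i j r h)).hom

omit [LinearOrder ι] in
theorem tensorToTaylor_ι {i j r : ℕ} (h : i + j = r)
    (x : TaylorModule n K ι₁ i ⊗[MvPolynomial (Fin n) K] TaylorModule n K ι₂ j) :
    tensorToTaylor K σ m₁ m₂ r (ιTaylor K m₁ m₂ i j r h x) = joinMap n K σ i j r h x :=
  ConcreteCategory.congr_hom (HomologicalComplex.ι_mapBifunctorDesc
    (K₁ := taylorOfFamily K m₁) (K₂ := taylorOfFamily K m₂) (c := ComplexShape.down ℕ)
    (F := MonoidalCategory.curriedTensor _) (A := ModuleCat.of _ (TaylorModule n K ι r))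
    (fun i j h => ModuleCat.ofHom (joinMap n K σ i j r h)) i j h) x

/-- The inverse of `tensorToTaylor`, which sends `e_U` to `e_S ⊗ e_T`, where `S` and `T` are
the parts of `U` that come from the two families. -/
def taylorToTensor (r : ℕ) : TaylorModule n K ι r →ₗ[MvPolynomial (Fin n) K]
    (HomologicalComplex.tensorObj (taylorOfFamily K m₁) (taylorOfFamily K m₂)).X r :=
  Finsupp.linearCombination _ fun U =>
    ιTaylor K m₁ m₂ (leftPart σ U.1).card (rightPart σ U.1).card r
      ((card_leftPart_add_card_rightPart σ U.1).trans U.2)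
      (Finsupp.single ⟨leftPart σ U.1, rfl⟩ 1 ⊗ₜ Finsupp.single ⟨rightPart σ U.1, rfl⟩ 1)

omit [LinearOrder ι] in
/-- The value of `taylorToTensor` at `e_U`, with the sizes of the two parts of `U` replaced by
variables `i` and `j`. -/
theorem taylorToTensor_single (r : ℕ) (U : {U : Finset ι // U.card = r})
    (p : MvPolynomial (Fin n) K) {i j : ℕ} (h : i + j = r) (S : {S : Finset ι₁ // S.card = i})
    (T : {T : Finset ι₂ // T.card = j}) (hS : leftPart σ U.1 = S.1) (hT : rightPart σ U.1 = T.1) :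
    taylorToTensor K σ m₁ m₂ r (Finsupp.single U p) =
      ιTaylor K m₁ m₂ i j r h (Finsupp.single S p ⊗ₜ Finsupp.single T 1) := by
  obtain ⟨S, rfl⟩ := S
  obtain ⟨T, rfl⟩ := T
  subst hS hT
  rw [taylorToTensor, Finsupp.linearCombination_single, ← map_smul, TensorProduct.smul_tmul',
    Finsupp.smul_single, smul_eq_mul, mul_one]

omit [LinearOrder ι] in
theorem tensorToTaylor_taylorToTensor (r : ℕ) :
    tensorToTaylor K σ m₁ m₂ r ∘ₗ taylorToTensor K σ m₁ m₂ r = LinearMap.id := by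
  refine Finsupp.lhom_ext fun U p => ?_
  rw [LinearMap.comp_apply, taylorToTensor_single K σ m₁ m₂ r U p
    ((card_leftPart_add_card_rightPart σ U.1).trans U.2) ⟨leftPart σ U.1, rfl⟩
    ⟨rightPart σ U.1, rfl⟩ rfl rfl, tensorToTaylor_ι, joinMap_single, mul_one]
  simp only [join_leftPart_rightPart, LinearMap.id_apply]

omit [LinearOrder ι] in
theorem taylorToTensor_tensorToTaylor (r : ℕ) :
    taylorToTensor K σ m₁ m₂ r ∘ₗ tensorToTaylor K σ m₁ m₂ r = LinearMap.id := by
  refine hom_ext_ιTaylor fun i j h x y => ?_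
  rw [LinearMap.comp_apply, tensorToTaylor_ι, LinearMap.id_apply]
  induction x using Finsupp.induction_linear with
  | zero => simp only [TensorProduct.zero_tmul, map_zero]
  | add x x' hx hx' => simp only [TensorProduct.add_tmul, map_add, hx, hx']
  | single S p =>
    induction y using Finsupp.induction_linear with
    | zero => simp only [TensorProduct.tmul_zero, map_zero]
    | add y y' hy hy' => simp only [TensorProduct.tmul_add, map_add, hy, hy']
    | single T q =>
      have hT : (Finsupp.single T q : TaylorModule n K ι₂ j) = q • Finsupp.single T 1 := by
        rw [Finsupp.smul_single, smul_eq_mul, mul_one]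
      rw [joinMap_single, taylorToTensor_single K σ m₁ m₂ r _ _ h S T
        (leftPart_join σ _ _) (rightPart_join σ _ _), hT, ← TensorProduct.smul_tmul,
        Finsupp.smul_single, smul_eq_mul, mul_comm]

omit [LinearOrder ι] in
/-- The differential of the tensor product of the Taylor complexes on its summands, after the map
`tensorToTaylor`. -/
theorem incl_tensorToTaylor_d {i j r : ℕ} (h : i + j = r + 1) (x : TaylorModule n K ι₁ i)
    (y : TaylorModule n K ι₂ j) :
    incl n K ι r (tensorToTaylor K σ m₁ m₂ r
      (((HomologicalComplex.tensorObj (taylorOfFamily K m₁) (taylorOfFamily K m₂)).d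
        (r + 1) r).hom (ιTaylor K m₁ m₂ i j (r + 1) h (x ⊗ₜ y)))) =
      totalJoin n K σ (totalD K m₁ (incl n K ι₁ i x)) (incl n K ι₂ j y) +
        (-1 : MvPolynomial (Fin n) K) ^ i •
          totalJoin n K σ (incl n K ι₁ i x) (totalD K m₂ (incl n K ι₂ j y)) := by
  have h0 : ((HomologicalComplex.tensorObj (taylorOfFamily K m₁) (taylorOfFamily K m₂)).d
        (r + 1) r).hom (ιTaylor K m₁ m₂ i j (r + 1) h (x ⊗ₜ y)) =
      (HomologicalComplex.mapBifunctor.d₁ (taylorOfFamily K m₁) (taylorOfFamily K m₂)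
        (MonoidalCategory.curriedTensor _) (ComplexShape.down ℕ) i j r).hom
          (x ⊗ₜ[MvPolynomial (Fin n) K] y) +
      (HomologicalComplex.mapBifunctor.d₂ (taylorOfFamily K m₁) (taylorOfFamily K m₂)
        (MonoidalCategory.curriedTensor _) (ComplexShape.down ℕ) i j r).hom
          (x ⊗ₜ[MvPolynomial (Fin n) K] y) := by
    rw [← HomologicalComplex.mapBifunctor.ι_D₁ _ _ _ _ (r + 1) r i j h,
      ← HomologicalComplex.mapBifunctor.ι_D₂ _ _ _ _ (r + 1) r i j h]
    rfl
  rw [h0, map_add, map_add]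
  congr 1
  · obtain _ | i := i
    · rw [HomologicalComplex.mapBifunctor.d₁_eq_zero _ _ _ _ _ _ _ (by simp),
        totalD_incl_zero, map_zero]
      simp
    · -- the sign of the first differential of the tensor product is `1`
      have hij : i + j = r := by omega
      rw [HomologicalComplex.mapBifunctor.d₁_eq (taylorOfFamily K m₁) (taylorOfFamily K m₂)
        (MonoidalCategory.curriedTensor _) (ComplexShape.down ℕ)
        (show (ComplexShape.down ℕ).Rel (i + 1) i from rfl) j r hij, taylorOfFamily_d]
      have h1 : (1 : ℤˣ) • ιTaylor K m₁ m₂ i j r hij (d K m₁ i x ⊗ₜ y) =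
        ιTaylor K m₁ m₂ i j r hij (d K m₁ i x ⊗ₜ y) := one_smul _ _
      change incl n K ι r (tensorToTaylor K σ m₁ m₂ r
        ((1 : ℤˣ) • ιTaylor K m₁ m₂ i j r hij (d K m₁ i x ⊗ₜ y))) = _
      rw [h1, tensorToTaylor_ι, incl_joinMap, incl_d]
  · obtain _ | j := j
    · rw [HomologicalComplex.mapBifunctor.d₂_eq_zero _ _ _ _ _ _ _ (by simp),
        totalD_incl_zero, map_zero]
      simp
    · -- the sign of the second differential is `(-1) ^ i`, with `-1` a unit of `ℤ`
      have hij : i + j = r := by omega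
      rw [HomologicalComplex.mapBifunctor.d₂_eq (taylorOfFamily K m₁) (taylorOfFamily K m₂)
        (MonoidalCategory.curriedTensor _) (ComplexShape.down ℕ) i
        (show (ComplexShape.down ℕ).Rel (j + 1) j from rfl) r hij, taylorOfFamily_d]
      have h1 : ((-1 : ℤˣ) ^ i) • ιTaylor K m₁ m₂ i j r hij (x ⊗ₜ d K m₂ j y) =
        (-1 : MvPolynomial (Fin n) K) ^ i • ιTaylor K m₁ m₂ i j r hij (x ⊗ₜ d K m₂ j y) := by
        obtain hi | hi := Nat.even_or_odd i
        · rw [hi.neg_one_pow, hi.neg_one_pow, one_smul, one_smul]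
        · rw [hi.neg_one_pow, hi.neg_one_pow, Units.neg_smul, neg_smul, one_smul, one_smul]
      change incl n K ι r (tensorToTaylor K σ m₁ m₂ r
        (((-1 : ℤˣ) ^ i) • ιTaylor K m₁ m₂ i j r hij (x ⊗ₜ d K m₂ j y))) = _
      rw [h1, map_smul, map_smul, tensorToTaylor_ι, incl_joinMap, incl_d]

variable {m₁ m₂ m}

/-- The tensor product of the Taylor complexes of two families of monomials that are coprime to
each other is the Taylor complex of the union of the families, if the order on the union lets the
members of the first family precede those of the second one. -/
def tensorIso (hl : ∀ a b, σ (.inl a) < σ (.inl b) ↔ a < b)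
    (hr : ∀ a b, σ (.inr a) < σ (.inr b) ↔ a < b) (hlr : ∀ a b, σ (.inl a) < σ (.inr b))
    (hm : ∀ x, m (σ x) = Sum.elim m₁ m₂ x) (hcop : ∀ a b x, m₁ a x = 0 ∨ m₂ b x = 0) :
    HomologicalComplex.tensorObj (taylorOfFamily K m₁) (taylorOfFamily K m₂) ≅
      taylorOfFamily K m :=
  HomologicalComplex.Hom.isoOfComponents
    (fun r => (LinearEquiv.ofLinearMap (tensorToTaylor K σ m₁ m₂ r) (taylorToTensor K σ m₁ m₂ r)
      (tensorToTaylor_taylorToTensor K σ m₁ m₂ r)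
      (taylorToTensor_tensorToTaylor K σ m₁ m₂ r)).toModuleIso) (by
    rintro _ r rfl
    rw [taylorOfFamily_d]
    suffices h : d K m r ∘ₗ tensorToTaylor K σ m₁ m₂ (r + 1) = tensorToTaylor K σ m₁ m₂ r ∘ₗ
        ((HomologicalComplex.tensorObj (taylorOfFamily K m₁) (taylorOfFamily K m₂)).d
          (r + 1) r).hom by
      ext1
      exact h
    refine hom_ext_ιTaylor fun i j h x y => incl_injective K r ?_
    rw [LinearMap.comp_apply, LinearMap.comp_apply, incl_tensorToTaylor_d, tensorToTaylor_ι,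
      incl_d, incl_joinMap, totalD_totalJoin_incl σ hl hr hlr hm hcop])

theorem joinMap_mem_taylorOfFamilyDeg (hm : ∀ x, m (σ x) = Sum.elim m₁ m₂ x)
    (hcop : ∀ a b x, m₁ a x = 0 ∨ m₂ b x = 0) {i j r : ℕ} (h : i + j = r) {a b : Fin n →₀ ℕ}
    {x : TaylorModule n K ι₁ i} {y : TaylorModule n K ι₂ j} (hx : x ∈ taylorOfFamilyDeg K m₁ i a)
    (hy : y ∈ taylorOfFamilyDeg K m₂ j b) :
    joinMap n K σ i j r h (x ⊗ₜ y) ∈ taylorOfFamilyDeg K m r (a + b) := by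
  refine map_mem_of_mem_taylorOfFamilyDeg ((joinMap n K σ i j r h).toAddMonoidHom.comp
    ((TensorProduct.mk (MvPolynomial (Fin n) K) (TaylorModule n K ι₁ i)
      (TaylorModule n K ι₂ j)).flip y).toAddMonoidHom) _ (fun S b₁ k₁ h₁ => ?_) hx
  refine map_mem_of_mem_taylorOfFamilyDeg ((joinMap n K σ i j r h).toAddMonoidHom.comp
    (TensorProduct.mk (MvPolynomial (Fin n) K) (TaylorModule n K ι₁ i) (TaylorModule n K ι₂ j)
      (Finsupp.single S (monomial b₁ k₁))).toAddMonoidHom) _ (fun T b₂ k₂ h₂ => ?_) hy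
  change joinMap n K σ i j r h (_ ⊗ₜ _) ∈ taylorOfFamilyDeg K m r _
  rw [joinMap_single, monomial_mul]
  refine single_mem_taylorOfFamilyDeg _ _ _ ?_
  rw [lcmExp_join σ hm hcop, ← h₁, ← h₂]
  abel

/-- The isomorphism `e_S ⊗ e_T ↦ e_{S ∪ T}` identifies the multigraded components, because the
multidegree `lcm (S ∪ T)` of `e_{S ∪ T}` is the sum of those of `e_S` and `e_T`. -/
theorem tensorToTaylor_mem_iff (hm : ∀ x, m (σ x) = Sum.elim m₁ m₂ x)
    (hcop : ∀ a b x, m₁ a x = 0 ∨ m₂ b x = 0) (r : ℕ) (c : Fin n →₀ ℕ)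
    (z : (HomologicalComplex.tensorObj (taylorOfFamily K m₁) (taylorOfFamily K m₂)).X r) :
    tensorToTaylor K σ m₁ m₂ r z ∈ taylorOfFamilyDeg K m r c ↔
      z ∈ tensorDeg (taylorOfFamily K m₁) (taylorOfFamily K m₂) (taylorOfFamilyDeg K m₁)
        (taylorOfFamilyDeg K m₂) r c := by
  constructor
  · intro hz
    rw [← LinearMap.id_apply (R := MvPolynomial (Fin n) K) z,
      ← taylorToTensor_tensorToTaylor K σ m₁ m₂ r]
    refine map_mem_of_mem_taylorOfFamilyDeg (taylorToTensor K σ m₁ m₂ r).toAddMonoidHom _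
      (fun U b k hb => ?_) hz
    have hU := (card_leftPart_add_card_rightPart σ U.1).trans U.2
    change taylorToTensor K σ m₁ m₂ r _ ∈ _
    rw [taylorToTensor_single K σ m₁ m₂ r U _ hU ⟨leftPart σ U.1, rfl⟩ ⟨rightPart σ U.1, rfl⟩
      rfl rfl]
    refine AddSubgroup.subset_closure ⟨_, _, hU, b + lcmExp m₁ (leftPart σ U.1),
      0 + lcmExp m₂ (rightPart σ U.1), _, _, ?_, single_mem_taylorOfFamilyDeg _ _ _ rfl,
      single_mem_taylorOfFamilyDeg _ 0 1 rfl, rfl⟩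
    rw [← hb, zero_add, add_assoc, ← lcmExp_join σ hm hcop, join_leftPart_rightPart]
  · refine fun hz => (AddSubgroup.closure_le ((taylorOfFamilyDeg K m r c).comap
      (tensorToTaylor K σ m₁ m₂ r).toAddMonoidHom)).2 ?_ hz
    rintro _ ⟨i, j, h, a, b, x, y, rfl, hx, hy, rfl⟩
    change tensorToTaylor K σ m₁ m₂ r (ιTaylor K m₁ m₂ i j r h (x ⊗ₜ y)) ∈
      taylorOfFamilyDeg K m r _
    rw [tensorToTaylor_ι]
    exact joinMap_mem_taylorOfFamilyDeg K σ hm hcop h hx hy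

end Tensor

/-! ### The Taylor complex of a transversal sum -/

/-- The tensor product of the Taylor complexes of two families that are coprime to each other is
the Taylor complex of their union, as multigraded complexes and for any order on the union. -/
theorem exists_tensorObj_iso {n : ℕ} {K : Type u} [Field K] {ι₁ ι₂ ι : Type} [LinearOrder ι₁]
    [LinearOrder ι₂] [LinearOrder ι] {m₁ : ι₁ → Fin n →₀ ℕ} {m₂ : ι₂ → Fin n →₀ ℕ}
    {m : ι → Fin n →₀ ℕ} (e : ι₁ ⊕ ι₂ ≃ ι) (hm : ∀ x, m (e x) = Sum.elim m₁ m₂ x)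
    (hcop : ∀ a b x, m₁ a x = 0 ∨ m₂ b x = 0) :
    ∃ φ : HomologicalComplex.tensorObj (taylorOfFamily K m₁) (taylorOfFamily K m₂) ≅
        taylorOfFamily K m,
      ∀ (r : ℕ) (c : Fin n →₀ ℕ)
        (z : (HomologicalComplex.tensorObj (taylorOfFamily K m₁) (taylorOfFamily K m₂)).X r),
        (φ.hom.f r).hom z ∈ taylorOfFamilyDeg K m r c ↔
          z ∈ tensorDeg (taylorOfFamily K m₁) (taylorOfFamily K m₂)
            (taylorOfFamilyDeg K m₁) (taylorOfFamilyDeg K m₂) r c := by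
  -- the members of both families, those of the first one coming first
  let m' : ι₁ ⊕ₗ ι₂ → Fin n →₀ ℕ := fun x => Sum.elim m₁ m₂ (ofLex x)
  have hm' : ∀ x, m' (toLex x) = Sum.elim m₁ m₂ x := fun x => rfl
  have he : ∀ x, m ((ofLex.trans e) x) = m' x := fun x => hm _
  refine ⟨tensorIso K toLex (fun a b => Sum.Lex.inl_lt_inl_iff) (fun a b => Sum.Lex.inr_lt_inr_iff)
    (fun a b => Sum.Lex.inl_lt_inr a b) hm' hcop ≪≫ reindexIso (ofLex.trans e) he,
    fun r c z => ?_⟩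
  rw [← tensorToTaylor_mem_iff K toLex hm' hcop, ← reindexEquiv_mem_iff (ofLex.trans e) he]
  rfl

end Taylor

end

theorem mainTheorem3 {n : ℕ} {K : Type*} [Field K] (I J : Ideal (MvPolynomial (Fin n) K))
    (hI : Taylor.IsMonomial I) (hJ : Taylor.IsMonomial J) (hI1 : I ≠ ⊤) (hJ1 : J ≠ ⊤)
    (hIJ : I ⊓ J = I * J)
    [LinearOrder (Taylor.minGens I)] [LinearOrder (Taylor.minGens J)]
    [LinearOrder (Taylor.minGens (I + J))] :
    (∃ φ : HomologicalComplex.tensorObj (Taylor.taylor I) (Taylor.taylor J) ≅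
        Taylor.taylor (I + J),
      ∀ (r : ℕ) (c : Fin n →₀ ℕ)
        (z : (HomologicalComplex.tensorObj (Taylor.taylor I) (Taylor.taylor J)).X r),
        (φ.hom.f r).hom z ∈ Taylor.taylorDeg (I + J) r c ↔
          z ∈ Taylor.tensorDeg (Taylor.taylor I) (Taylor.taylor J)
            (Taylor.taylorDeg I) (Taylor.taylorDeg J) r c) ∧
    (∀ r : ℕ, 1 ≤ r →
      (HomologicalComplex.tensorObj (Taylor.taylor I) (Taylor.taylor J)).ExactAt r) ∧
    Nonempty ((HomologicalComplex.tensorObj (Taylor.taylor I) (Taylor.taylor J)).homology 0 ≅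
      ModuleCat.of (MvPolynomial (Fin n) K) (MvPolynomial (Fin n) K ⧸ (I + J))) := by
  have hcop : ∀ a ∈ Taylor.minGens I, ∀ b ∈ Taylor.minGens J, ∀ x, a x = 0 ∨ b x = 0 :=
    fun a ha b hb x => Taylor.coprime_of_inf_eq_mul hI hJ hIJ ha hb x
  obtain ⟨e, he⟩ := Taylor.exists_equiv_minGens_add hI hJ hI1 hJ1 hcop
  obtain ⟨φ, hφ⟩ := Taylor.exists_tensorObj_iso (K := K)
    (m₁ := (Subtype.val : Taylor.minGens I → _)) (m₂ := (Subtype.val : Taylor.minGens J → _))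
    (m := (Subtype.val : Taylor.minGens (I + J) → _)) e he fun a b => hcop a a.2 b b.2
  refine ⟨⟨φ, hφ⟩, fun r hr => ?_, ?_⟩
  · exact (Taylor.taylorOfFamily_exactAt K _ hr).of_iso φ.symm
  · obtain ⟨ψ⟩ := Taylor.nonempty_homology_zero_iso K
      (Subtype.val : Taylor.minGens (I + J) → Fin n →₀ ℕ)
    rw [Subtype.range_coe, (hI.sup hJ).span_minGens] at ψ
    exact ⟨(HomologicalComplex.homologyFunctor _ _ 0).mapIso φ ≪≫ ψ⟩
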